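/- Fix a standard effective enumeration of the partial computable functions on $\mathbb{N}$ (so that every such function has indices), and let every finite set $\{x_1,\dots,x_k\}\subseteq\mathbb{N}$ have the canonical index $2^{x_1}+\dots+2^{x_k}$. A computable ring is a commutative ring $A$ whose elements are identified, through an injective coding $\nu\colon A\to\mathbb{N}$, with the elements of a computable set $\nu(A)\subseteq\mathbb{N}$, on which addition and multiplication are computable; an index for it consists of an index for a decision procedure for $\nu(A)$ and indices for the addition and the multiplication. A strongly computable finite factorization domain (SCFFD) is a computable integral domain $A$ for which there is a computable function $D$ such that, for every $a\in A\setminus\{0\}$, $D(a)$ is defined and is the canonical index of the finite set of (codes of) all divisors of $a$ in $A$; nothing is required of $D(0)$. Code a polynomial in $A[x]$ by (a number coding) the list of the codes of its coefficients from the leading one down, the zero polynomial by the empty list. Theorem. If $A$ is an infinite SCFFD, then so is $A[x]$, with this coding. Moreover, there are computable functions $R$ and $\Delta$, not depending on $A$, such that for every infinite computable integral domain $A$ with index $r$ and every index $d$ of a function $D$ witnessing that $A$ is an SCFFD, $R(r)$ is an index for the computable ring $A[x]$, and $\Delta(r,d)$ is an index of a function $D'$ that witnesses that $A[x]$ is an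 SCFFD and extends $D$: identifying $A$ with the constant polynomials, for every $a\in A$ at which $D$ is defined, $D'$ is defined at $a$ as well, and if $D(a)$ is the canonical index of a set of elements of $A$, then $D'(a)$ is the canonical index of the same set in $A[x]$. -/

import Mathlib

open Polynomial

universe u

/-- Codes of programs for partial computable functions `ℕ →. ℕ`; these serve as indices. -/
abbrev Index : Type := Nat.Partrec.Code

/-- An index for a computable ring: a triple of programs `(m, p, t)`, where `m` decides the
underlying set, `p` computes addition and `t` computes multiplication. -/
abbrev RingIndex : Type := Index × Index × Index

/-- `ν` identifies the ring `A` with a ring whose underlying set is the computable set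
`Set.range ν ⊆ ℕ`, with computable addition and multiplication, and `r` is an index for it.
(A ring whose underlying set literally is a set of natural numbers is the case where `ν` is the
inclusion.) -/
structure IsRingIndex {A : Type*} [CommRing A] (ν : A → ℕ) (r : RingIndex) : Prop where
  injective : Function.Injective ν
  mem : ∀ n ∈ Set.range ν, 1 ∈ r.1.eval n
  not_mem : ∀ n ∉ Set.range ν, 0 ∈ r.1.eval n
  add : ∀ a b : A, ν (a + b) ∈ r.2.1.eval (Nat.pair (ν a) (ν b))
  mul : ∀ a b : A, ν (a * b) ∈ r.2.2.eval (Nat.pair (ν a) (ν b))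

/-- The finite set of natural numbers with canonical index `n`: if `n = 2 ^ x₁ + ⋯ + 2 ^ xₖ` with
`x₁ < ⋯ < xₖ`, this is `{x₁, …, xₖ}`. -/
def canonicalFinset (n : ℕ) : Finset ℕ := n.bitIndices.toFinset

/-- `n` is the canonical index of (the set of codes of the elements of) the set `s`. -/
def IsCanonicalIndex {A : Type*} (ν : A → ℕ) (n : ℕ) (s : Set A) : Prop :=
  (canonicalFinset n : Set ℕ) = ν '' s

/-- `d` is an index for a divisor function `D`: for every nonzero `a`, the value `D a` is defined,
and it is the canonical index of the set of divisors of `a`. Nothing is asked at `a = 0`. -/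
def IsDivisorIndex {A : Type*} [CommRing A] (ν : A → ℕ) (d : Index) : Prop :=
  ∀ a : A, a ≠ 0 → ∃ n ∈ d.eval (ν a), IsCanonicalIndex ν n {b : A | b ∣ a}

/-- `A`, coded by `ν`, is a strongly computable finite factorization domain. -/
def IsSCFFD (A : Type*) [CommRing A] (ν : A → ℕ) : Prop :=
  IsDomain A ∧ (∃ r : RingIndex, IsRingIndex ν r) ∧ ∃ d : Index, IsDivisorIndex ν d

/-- The standard coding of `A[X]`: a polynomial is coded by the list of the codes of its
coefficients, from the leading one down to the constant one (the empty list for `0`), and that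
list by a number, through the standard computable coding of `List ℕ`. -/
noncomputable def polyCode {A : Type*} [CommRing A] (ν : A → ℕ) (f : A[X]) : ℕ :=
  Encodable.encode (f.coeffList.map ν)

/-- The function `D'` on `A[X]` with index `d'` extends the function `D` on `A` with index `d`:
wherever `D a` is defined, so is `D' a`, and if `D a` is (the canonical index of) a set `s` of
elements of `A`, then `D' a` is (the canonical index of) the same set, `A` being identified with
the constant polynomials. -/
def ExtendsToPoly {A : Type*} [CommRing A] (ν : A → ℕ) (d d' : Index) : Prop :=
  ∀ a : A, ∀ n ∈ d.eval (ν a), ∃ n' ∈ d'.eval (polyCode ν (C a)),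
    ∀ s : Set A, IsCanonicalIndex ν n s → IsCanonicalIndex (polyCode ν) n' ((C : A → A[X]) '' s)

/-!
The theorem is Kronecker's factorization method, arranged so that no division in `A` is needed.

A divisor `g` of a nonzero polynomial `f` of degree `< N` is determined by its values at `N`
distinct points `a i` with `f (a i) ≠ 0`, which exist as `A` is an infinite domain. These values
divide the values `f (a i)`, so they lie in a finite set that `D` provides. To bound the polynomials with
values in a finite set `S`, write `g = c + (X - a) * q` with `c = g a ∈ S` (`mem_of_eval_mem`). The
values of `q` at the remaining points are quotients `(g (a j) - g a) / (a j - a)`. Instead of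
computing them, one uses that each of them is zero or a divisor of the nonzero difference of two
elements of `S`, hence lies in a finite set that `D` provides again. After `N` such steps there
results a finite list of polynomials that contains all divisors of `f` (`mem_of_dvd`), and the
divisors are the members `g` of the list with `g * k = f` for some `k` in the list.

On the side of computability, no algorithm is written down. Everything is expressed by recursively
enumerable relations between the indices `r`, `d`, the inputs and the outputs, built from the atomic
relations `y ∈ c.eval x` by conjunction, disjunction, existential quantification and bounded
universal quantification. A uniform search then turns an r.e. relation into a computable map from
parameters to indices (`REPred.exists_computable_index`). For this it is enough that any output
standing in the relation is correct, and that there is one; functionality of the relation is not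
required. The intermediate lists of the method appear as existentially quantified certificates
(`DivisorBound`). For an index `r` of `A`, quantifying over codes amounts to quantifying over
elements of `A` and `A[X]`, and the relations on codes become identities in `A[X]`
(`IsRingIndex.polyAddRel_iff`, `IsRingIndex.polyMulRel_iff`, `IsRingIndex.hornerRel_iff`).

The divisors of a nonzero constant are constants, so that `D'` extends `D` away from zero as soon as
it is correct. At the zero polynomial, `D'` is defined by translating the value of `D` at zero
(`ZeroDivisorRel`).
-/

open Encodable Nat.Partrec

/-! ### Recursively enumerable predicates -/

-- `fun_prop` then discharges the side goals on primitive recursive functions.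
attribute [fun_prop] Primrec
attribute [fun_prop] Primrec.id Primrec.const Primrec.comp Primrec.fst Primrec.snd Primrec.pair
  Primrec.encode Primrec.list_reverse Primrec.list_length

section

variable {α β : Type*} [Primcodable α] [Primcodable β]

@[fun_prop]
theorem Primrec.add_comp {f g : α → ℕ} (hf : Primrec f) (hg : Primrec g) :
    Primrec fun a => f a + g a :=
  Primrec.nat_add.comp hf hg

@[fun_prop]
theorem Primrec.sub_comp {f g : α → ℕ} (hf : Primrec f) (hg : Primrec g) :
    Primrec fun a => f a - g a :=
  Primrec.nat_sub.comp hf hg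

@[fun_prop]
theorem Primrec.natPair_comp {f g : α → ℕ} (hf : Primrec f) (hg : Primrec g) :
    Primrec fun a => Nat.pair (f a) (g a) :=
  Primrec₂.natPair.comp hf hg

@[fun_prop]
theorem Primrec.getD_comp {f : α → List β} {g : α → ℕ} {h : α → β} (hf : Primrec f)
    (hg : Primrec g) (hh : Primrec h) : Primrec fun a => (f a).getD (g a) (h a) := by
  simp only [List.getD_eq_getElem?_getD]
  exact Primrec.option_getD.comp (Primrec.list_getElem?.comp hf hg) hh

@[fun_prop]
theorem Primrec.cons_comp {f : α → β} {g : α → List β} (hf : Primrec f) (hg : Primrec g) :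
    Primrec fun a => f a :: g a :=
  Primrec.list_cons.comp hf hg

@[fun_prop]
theorem Primrec.append_comp {f g : α → List β} (hf : Primrec f) (hg : Primrec g) :
    Primrec fun a => f a ++ g a :=
  Primrec.list_append.comp hf hg

@[fun_prop]
theorem Primrec.head?_comp {f : α → List β} (hf : Primrec f) : Primrec fun a => (f a).head? :=
  Primrec.list_head?.comp hf

@[fun_prop]
theorem Primrec.some_comp {f : α → β} (hf : Primrec f) : Primrec fun a => some (f a) :=
  Primrec.option_some.comp hf

theorem PrimrecPred.rePred {p : α → Prop} (hp : PrimrecPred p) : REPred p :=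
  hp.computablePred.to_re

/-- The normal form of r.e. predicates: the existential quantifier ranges over computation bounds,
so the matrix may be taken to be primitive recursive and monotone. -/
theorem rePred_iff_exists_primrecRel {p : α → Prop} :
    REPred p ↔ ∃ R : α → ℕ → Prop, PrimrecRel R ∧ (∀ a m n, m ≤ n → R a m → R a n) ∧
      ∀ a, p a ↔ ∃ n, R a n := by
  constructor
  · intro hp
    obtain ⟨c, hc⟩ := Code.exists_code.1 hp
    refine ⟨fun a k => (Code.evaln k c (encode a)).isSome, ?_, ?_, fun a => ?_⟩
    · refine Primrec.primrecPred (p := fun x : α × ℕ => _) ?_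
      simp only [Bool.decide_eq_true]
      exact Primrec.option_isSome.comp (Code.primrec_evaln.comp
        ((Primrec.snd.pair (Primrec.const c)).pair (Primrec.encode.comp Primrec.fst)))
    · intro a m n hmn h
      obtain ⟨x, hx⟩ := Option.isSome_iff_exists.1 h
      exact Option.isSome_iff_exists.2 ⟨x, Code.evaln_mono hmn hx⟩
    · have h1 : p a ↔ ∃ x, x ∈ Code.eval c (encode a) := by
        rw [hc]
        simp [Part.mem_assert_iff]
      rw [h1]
      simp only [Code.evaln_complete, Option.isSome_iff_exists, Option.mem_def]
      exact exists_comm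
  · rintro ⟨R, ⟨hd, hR⟩, -, h⟩
    let _ : ∀ a n, Decidable (R a n) := fun a n => hd (a, n)
    have : Partrec fun a => Nat.rfind fun n => Part.some (decide (R a n)) :=
      Partrec.rfind (p := fun a n => Part.some (decide (R a n))) hR.to_comp.partrec
    exact this.dom_re.of_eq fun a =>
      (Nat.rfind_dom.trans (exists_congr fun n => by simp)).trans (h a).symm

namespace REPred

protected theorem and {p q : α → Prop} (hp : REPred p) (hq : REPred q) :
    REPred fun a => p a ∧ q a := by
  obtain ⟨R, hR, mR, h⟩ := rePred_iff_exists_primrecRel.1 hp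
  obtain ⟨S, hS, mS, h'⟩ := rePred_iff_exists_primrecRel.1 hq
  refine rePred_iff_exists_primrecRel.2 ⟨fun a n => R a n ∧ S a n, PrimrecPred.and hR hS,
    fun a m n hmn => And.imp (mR a m n hmn) (mS a m n hmn), fun a => ?_⟩
  rw [h, h']
  exact ⟨fun ⟨⟨m, hm⟩, n, hn⟩ => ⟨max m n, mR _ _ _ (le_max_left _ _) hm,
    mS _ _ _ (le_max_right _ _) hn⟩, fun ⟨n, hn⟩ => ⟨⟨n, hn.1⟩, n, hn.2⟩⟩

protected theorem or {p q : α → Prop} (hp : REPred p) (hq : REPred q) :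
    REPred fun a => p a ∨ q a := by
  obtain ⟨R, hR, mR, h⟩ := rePred_iff_exists_primrecRel.1 hp
  obtain ⟨S, hS, mS, h'⟩ := rePred_iff_exists_primrecRel.1 hq
  refine rePred_iff_exists_primrecRel.2 ⟨fun a n => R a n ∨ S a n, PrimrecPred.or hR hS,
    fun a m n hmn => Or.imp (mR a m n hmn) (mS a m n hmn), fun a => ?_⟩
  rw [h, h', ← exists_or]

protected theorem comp {p : β → Prop} {f : α → β} (hp : REPred p) (hf : Primrec f) :
    REPred fun a => p (f a) :=
  Partrec.comp hp hf.to_comp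

/-- The projection of an r.e. predicate is r.e. -/
theorem proj {p : α → β → Prop} (hp : REPred fun x : α × β => p x.1 x.2) :
    REPred fun a => ∃ b, p a b := by
  obtain ⟨R, hR, mR, h⟩ := rePred_iff_exists_primrecRel.1 hp
  have hR' : PrimrecRel fun (k : ℕ) (x : α × ℕ) =>
      ∃ b ∈ (decode (α := β) k).toList, R (x.1, b) x.2 :=
    PrimrecRel.comp (PrimrecRel.exists_mem_list (R := fun b (x : α × ℕ) => R (x.1, b) x.2)
      (PrimrecRel.comp hR (by fun_prop) (by fun_prop)))
      (Primrec.optionToList.comp (Primrec.decode.comp Primrec.fst)) Primrec.snd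
  refine rePred_iff_exists_primrecRel.2
    ⟨fun a n => ∃ k < n, ∃ b ∈ (decode (α := β) k).toList, R (a, b) n, ?_, ?_, fun a => ?_⟩
  · exact (hR'.exists_mem_list.comp (f := fun x : α × ℕ => List.range x.2) (g := fun x => x)
      (Primrec.list_range.comp (by fun_prop)) (by fun_prop)).of_eq fun x => by simp
  · rintro a m n hmn ⟨k, hk, b, hb, hR⟩
    exact ⟨k, by omega, b, hb, mR _ _ _ hmn hR⟩
  · constructor
    · rintro ⟨b, hb⟩
      obtain ⟨n, hn⟩ := (h (a, b)).1 hb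
      exact ⟨max n (encode b + 1), encode b, by omega, b, by simp, mR _ _ _ (le_max_left _ _) hn⟩
    · rintro ⟨n, k, -, b, -, hR⟩
      exact ⟨b, (h (a, b)).2 ⟨n, hR⟩⟩

/-- R.e. predicates are closed under quantification over the members of a list: a common
computation bound exists, by monotonicity. -/
theorem forall_mem {p : α → β → Prop} {l : α → List β} (hp : REPred fun x : α × β => p x.1 x.2)
    (hl : Primrec l) : REPred fun a => ∀ b ∈ l a, p a b := by
  obtain ⟨R, hR, mR, h⟩ := rePred_iff_exists_primrecRel.1 hp
  refine rePred_iff_exists_primrecRel.2 ⟨fun a n => ∀ b ∈ l a, R (a, b) n, ?_, ?_, fun a => ?_⟩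
  · exact PrimrecRel.comp (PrimrecRel.forall_mem_list (R := fun b (x : α × ℕ) => R (x.1, b) x.2)
      (PrimrecRel.comp hR (by fun_prop) (by fun_prop))) (f := fun x : α × ℕ => l x.1)
      (g := fun x => x) (by fun_prop) (by fun_prop)
  · exact fun a m n hmn H b hb => mR _ _ _ hmn (H b hb)
  · constructor
    · intro H
      choose! k hk using fun b hb => (h (a, b)).1 (H b hb)
      refine ⟨((l a).map k).sum, fun b hb => mR _ _ _ ?_ (hk b hb)⟩
      exact List.single_le_sum (by simp) _ (List.mem_map_of_mem hb)
    · exact fun ⟨n, hn⟩ b hb => (h (a, b)).2 ⟨n, hn b hb⟩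

theorem forall_lt {p : α → ℕ → Prop} {n : α → ℕ} (hp : REPred fun x : α × ℕ => p x.1 x.2)
    (hn : Primrec n) : REPred fun a => ∀ i < n a, p a i :=
  (forall_mem hp (Primrec.list_range.comp hn)).of_eq fun a => by simp

theorem eq {f g : α → β} (hf : Primrec f) (hg : Primrec g) : REPred fun a => f a = g a :=
  (Primrec.eq.comp hf hg).rePred

theorem ne {f g : α → β} (hf : Primrec f) (hg : Primrec g) : REPred fun a => f a ≠ g a :=
  (Primrec.eq.comp hf hg).not.rePred

theorem mem {f : α → β} {l : α → List β} (hf : Primrec f) (hl : Primrec l) :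
    REPred fun a => f a ∈ l a :=
  ((PrimrecRel.exists_mem_list (R := fun b b' : β => b = b') Primrec.eq).comp hl hf).rePred.of_eq
    fun a => by simp

theorem mem_eval {c : α → Index} {x y : α → ℕ} (hc : Primrec c) (hx : Primrec x)
    (hy : Primrec y) : REPred fun a => y a ∈ (c a).eval (x a) := by
  have h : REPred fun a => ∃ k, some (y a) = Code.evaln k (c a) (x a) := by
    refine REPred.proj (REPred.eq (by fun_prop) ?_)
    exact Code.primrec_evaln.comp
      ((Primrec.snd.pair (hc.comp Primrec.fst)).pair (hx.comp Primrec.fst))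
  exact h.of_eq fun a => by simp [Code.evaln_complete, eq_comm]

end REPred

theorem mem_canonicalFinset {x n : ℕ} : x ∈ canonicalFinset n ↔ n.testBit x := by
  simp [canonicalFinset]

theorem lt_of_mem_canonicalFinset {x n : ℕ} (h : x ∈ canonicalFinset n) : x < n := by
  have := Nat.two_pow_le_of_mem_bitIndices (List.mem_toFinset.1 h)
  exact Nat.lt_two_pow_self.trans_le this

theorem exists_canonicalFinset_eq (s : Finset ℕ) : ∃ n, canonicalFinset n = s :=
  ⟨_, Finset.toFinset_bitIndices_sum_two_pow s⟩

theorem primrecRel_mem_canonicalFinset : PrimrecRel fun x n => x ∈ canonicalFinset n := by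
  have hpow : Primrec₂ fun a b : ℕ => a ^ b := Primrec₂.unpaired'.1 Nat.Primrec.pow
  have h : PrimrecRel fun x n : ℕ => n / 2 ^ x % 2 = 1 :=
    Primrec.eq.comp (Primrec.nat_mod.comp (Primrec.nat_div.comp Primrec.snd
      (hpow.comp (Primrec.const 2) Primrec.fst)) (Primrec.const 2)) (Primrec.const 1)
  exact h.of_eq fun x n => by simp [mem_canonicalFinset, Nat.testBit_eq_decide_div_mod_eq]

namespace REPred

theorem mem_canonicalFinset {x n : α → ℕ} (hx : Primrec x) (hn : Primrec n) :
    REPred fun a => x a ∈ canonicalFinset (n a) :=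
  (primrecRel_mem_canonicalFinset.comp hx hn).rePred

theorem forall_mem_canonicalFinset {p : α → ℕ → Prop} {n : α → ℕ}
    (hp : REPred fun x : α × ℕ => p x.1 x.2) (hn : Primrec n) :
    REPred fun a => ∀ x ∈ canonicalFinset (n a), p a x := by
  have h : REPred fun a => ∀ x < n a, x ∉ canonicalFinset (n a) ∨ p a x :=
    forall_lt (.or (primrecRel_mem_canonicalFinset.comp (by fun_prop) (by fun_prop)).not.rePred hp)
      hn
  refine h.of_eq fun a => forall_congr' fun x => ?_
  have := @lt_of_mem_canonicalFinset x (n a)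
  tauto

/-- Uniformization by search: from parameters `s` one computes a program which, given `x`, finds
some `y` with `P s x y` whenever there is one. -/
theorem exists_computable_index {P : α → ℕ → ℕ → Prop}
    (hP : REPred fun q : (α × ℕ) × ℕ => P q.1.1 q.1.2 q.2) :
    ∃ Φ : α → Index, Computable Φ ∧ ∀ s x, (∀ y ∈ (Φ s).eval x, P s x y) ∧
      ((∃ y, P s x y) → ∃ y ∈ (Φ s).eval x, P s x y) := by
  obtain ⟨R, ⟨hd, hR⟩, -, h⟩ := rePred_iff_exists_primrecRel.1 hP
  let _ : ∀ q k, Decidable (R q k) := fun q k => hd (q, k)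
  -- The search runs over pairs of a candidate `y` and a computation bound.
  let F : α × ℕ →. ℕ := fun q =>
    (Nat.rfind fun n => Part.some (decide (R (q, n.unpair.1) n.unpair.2))).map fun n => n.unpair.1
  have hF : Partrec F := by
    refine Partrec.map (Partrec.rfind
      (p := fun q n => Part.some (decide (R (q, n.unpair.1) n.unpair.2))) ?_) ?_
    · refine Computable.partrec (Primrec.to_comp ?_)
      exact hR.comp ((Primrec.fst.pair (Primrec.fst.comp (Primrec.unpair.comp Primrec.snd))).pair
        (Primrec.snd.comp (Primrec.unpair.comp Primrec.snd)))
    · exact (Primrec.fst.comp (Primrec.unpair.comp Primrec.snd)).to_comp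
  have key : ∀ q y, y ∈ F q → P q.1 q.2 y := by
    intro q y hy
    obtain ⟨n, hn, rfl⟩ := (Part.mem_map_iff _).1 hy
    exact (h (q, n.unpair.1)).2 ⟨_, by simpa using Nat.rfind_spec hn⟩
  obtain ⟨c, hc⟩ := Code.exists_code.1 hF
  have hev : ∀ s x, (Code.curry c (encode s)).eval x = F (s, x) := fun s x => by
    rw [Code.eval_curry, hc]
    have : decode (α := α × ℕ) (Nat.pair (encode s) x) = some (s, x) := encodek (s, x)
    simp only [this, Part.coe_some, Part.bind_some]
    exact Part.map_id' (fun _ => rfl) _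
  refine ⟨fun s => Code.curry c (encode s),
    (Code.primrec₂_curry.comp (Primrec.const c) Primrec.encode).to_comp, fun s x => ?_⟩
  rw [hev]
  refine ⟨fun y hy => key (s, x) y hy, fun ⟨y, hy⟩ => ?_⟩
  obtain ⟨k, hk⟩ := (h ((s, x), y)).1 hy
  have hdom : (F (s, x)).Dom := by
    rw [Part.dom_iff_mem]
    have : ∃ n, n ∈ Nat.rfind fun n =>
        Part.some (decide (R ((s, x), n.unpair.1) n.unpair.2)) :=
      Part.dom_iff_mem.1 (Nat.rfind_dom.2 ⟨Nat.pair y k, by simpa using hk, by simp⟩)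
    obtain ⟨n, hn⟩ := this
    exact ⟨_, Part.mem_map _ hn⟩
  obtain ⟨y', hy'⟩ := Part.dom_iff_mem.1 hdom
  exact ⟨y', hy', key (s, x) y' hy'⟩

end REPred

end

/-! ### Interpolation in Newton form -/

section

variable {A : Type*} [CommRing A]

/-- Kronecker's bound on the polynomials whose values at `k` points lie in a prescribed set, in a
division-free form. Writing `g = C c + (X - C (a k)) * q`, with `c = g (a k)`, each value
`q (a j) = (g (a j) - c) / (a j - a k)` is `0` or divides the nonzero difference of two values
of `g`. So if `S i` bounds the values at one stage, then `0` and the divisors of the differences of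
elements of `S i` bound them at the next stage, at which one point fewer is left. -/
theorem mem_of_eval_mem [IsDomain A] {a : ℕ → A} {N : ℕ} (ha : ∀ i < N, ∀ j < i, a i ≠ a j)
    {S : ℕ → Set A} {L : ℕ → Set A[X]} (hS0 : ∀ i < N, 0 ∈ S (i + 1))
    (hS : ∀ i < N, ∀ u ∈ S i, ∀ v ∈ S i, u ≠ v → ∀ w, w ∣ u - v → w ∈ S (i + 1))
    (hL0 : 0 ∈ L 0)
    (hL : ∀ i < N, ∀ c ∈ S (N - (i + 1)), ∀ g ∈ L i, C c + (X - C (a i)) * g ∈ L (i + 1)) :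
    ∀ k ≤ N, ∀ g : A[X], g.degree < k → (∀ j < k, g.eval (a j) ∈ S (N - k)) → g ∈ L k := by
  intro k
  induction k with
  | zero =>
    intro _ g hg _
    have : g = 0 := by simpa using hg
    exact this ▸ hL0
  | succ k ih =>
    intro hk g hg hgS
    set q := g /ₘ (X - C (a k)) with hq
    have hgq : C (g.eval (a k)) + (X - C (a k)) * q = g := by
      rw [← modByMonic_X_sub_C_eq_C_eval]
      exact modByMonic_add_div g (X - C (a k))
    have hev : ∀ j, (a j - a k) * q.eval (a j) = g.eval (a j) - g.eval (a k) := fun j => by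
      conv_rhs => rw [← hgq]
      simp
    rw [← hgq]
    refine hL k (by omega) _ (hgS k (by omega)) q (ih (by omega) q ?_ fun j hj => ?_)
    · by_cases hq0 : q = 0
      · rw [hq0, degree_zero]
        exact WithBot.bot_lt_coe k
      · have hg0 : g ≠ 0 := by
          rintro rfl
          simp [hq] at hq0
        have h1 : q.natDegree = g.natDegree - 1 := natDegree_divByMonic g (monic_X_sub_C _) |>.trans
          (by rw [natDegree_X_sub_C])
        have h2 : 0 < g.natDegree := by
          by_contra h
          refine hq0 ((divByMonic_eq_zero_iff (monic_X_sub_C _)).2 ?_)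
          rw [degree_X_sub_C, degree_eq_natDegree hg0]
          exact_mod_cast (by omega : g.natDegree < 1)
        rw [degree_eq_natDegree hg0] at hg
        rw [degree_eq_natDegree hq0]
        have : g.natDegree < k + 1 := by exact_mod_cast hg
        exact_mod_cast (by omega : q.natDegree < k)
    · have hN : N - k = N - (k + 1) + 1 := by omega
      rw [hN]
      by_cases he : g.eval (a j) = g.eval (a k)
      · have h := hev j
        rw [he, sub_self, mul_eq_zero, sub_eq_zero] at h
        rw [h.resolve_left (ha k (by omega) j hj).symm]
        exact hS0 _ (by omega)
      · exact hS _ (by omega) _ (hgS j (by omega)) _ (hgS k (by omega)) he _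
          ⟨a j - a k, by rw [← hev, mul_comm]⟩

/-- Every divisor of `f` is among the polynomials in the sense of `mem_of_eval_mem`, if the first
set `S 0` contains the divisors of the values of `f`. -/
theorem mem_of_dvd [IsDomain A] {f : A[X]} (hf : f ≠ 0) {a : ℕ → A} {N : ℕ} (hN : f.natDegree < N)
    (ha : ∀ i < N, ∀ j < i, a i ≠ a j) {S : ℕ → Set A} {L : ℕ → Set A[X]}
    (hSf : ∀ i < N, ∀ w, w ∣ f.eval (a i) → w ∈ S 0) (hS0 : ∀ i < N, 0 ∈ S (i + 1))
    (hS : ∀ i < N, ∀ u ∈ S i, ∀ v ∈ S i, u ≠ v → ∀ w, w ∣ u - v → w ∈ S (i + 1))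
    (hL0 : 0 ∈ L 0)
    (hL : ∀ i < N, ∀ c ∈ S (N - (i + 1)), ∀ g ∈ L i, C c + (X - C (a i)) * g ∈ L (i + 1))
    {g : A[X]} (hg : g ∣ f) : g ∈ L N := by
  refine mem_of_eval_mem ha hS0 hS hL0 hL N le_rfl g ?_ fun j hj => ?_
  · refine (degree_le_of_dvd hg hf).trans_lt ?_
    rw [degree_eq_natDegree hf]
    exact_mod_cast hN
  · rw [Nat.sub_self]
    exact hSf j hj _ (eval_dvd hg)

theorem exists_finset_mem_of_dvd_sub (hfin : ∀ b : A, b ≠ 0 → {w | w ∣ b}.Finite)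
    (S₀ : Finset A) : ∃ S : ℕ → Finset A, S 0 = S₀ ∧ ∀ i, 0 ∈ S (i + 1) ∧
      ∀ u ∈ S i, ∀ v ∈ S i, u ≠ v → ∀ w, w ∣ u - v → w ∈ S (i + 1) := by
  classical
  choose! D hD using fun b hb => (hfin b hb).exists_finset
  refine ⟨fun n => Nat.rec S₀ (fun _ T => insert 0 ((T ×ˢ T).biUnion fun p => D (p.1 - p.2))) n,
    rfl, fun i => ⟨Finset.mem_insert_self _ _, fun u hu v hv huv w hw => ?_⟩⟩
  refine Finset.mem_insert_of_mem (Finset.mem_biUnion.2 ⟨(u, v), Finset.mk_mem_product hu hv, ?_⟩)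
  exact (hD _ (sub_ne_zero.2 huv) w).2 hw

theorem exists_finset_newton_mem (a : ℕ → A) (T : ℕ → Finset A) : ∃ L : ℕ → Finset A[X],
    0 ∈ L 0 ∧ ∀ i, ∀ c ∈ T i, ∀ g ∈ L i, C c + (X - C (a i)) * g ∈ L (i + 1) := by
  classical
  exact ⟨fun n => Nat.rec {0}
    (fun i L => Finset.image₂ (fun c g => C c + (X - C (a i)) * g) (T i) L) n, by simp,
    fun i c hc g hg => Finset.mem_image₂_of_mem hc hg⟩

theorem exists_injective_eval_ne_zero [IsDomain A] [Infinite A] {f : A[X]} (hf : f ≠ 0) :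
    ∃ a : ℕ → A, Function.Injective a ∧ ∀ i, f.eval (a i) ≠ 0 := by
  have hinf : {x : A | f.eval x ≠ 0}.Infinite := by
    have : {x : A | f.eval x = 0}.Finite := finite_setOfPred_isRoot hf
    exact this.infinite_compl
  refine ⟨fun i => hinf.natEmbedding _ i, fun i j h => ?_, fun i => (hinf.natEmbedding _ i).2⟩
  exact (hinf.natEmbedding _).injective (Subtype.ext h)

end

/-! ### Codes of polynomials and the r.e. relations on them -/

/-- The code of the `i`-th coefficient of the polynomial whose list of coefficient codes, from the
leading one down, is `l`; here `z` is the code of zero. -/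
def coeffCode (z : ℕ) (l : List ℕ) (i : ℕ) : ℕ := l.reverse.getD i z

/-- The list of the codes of the coefficients, from the leading one down; `polyCode` is the number
encoding it. -/
noncomputable def polyList {A : Type*} [CommRing A] (ν : A → ℕ) (f : A[X]) : List ℕ :=
  f.coeffList.map ν

/-- `z` is the code of zero: an element of the ring with `z + z = z`. -/
def IsZeroCode (r : RingIndex) (z : ℕ) : Prop :=
  1 ∈ r.1.eval z ∧ z ∈ r.2.1.eval (Nat.pair z z)

/-- `l` lists the codes of the coefficients of some polynomial. -/
def IsPolyList (r : RingIndex) (z : ℕ) (l : List ℕ) : Prop :=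
  l.head? ≠ some z ∧ ∀ x ∈ l, 1 ∈ r.1.eval x

/-- The relation `f + g = k` on lists of coefficient codes. -/
def PolyAddRel (r : RingIndex) (z : ℕ) (f g k : List ℕ) : Prop :=
  ∀ i < f.length + g.length + k.length,
    coeffCode z k i ∈ r.2.1.eval (Nat.pair (coeffCode z f i) (coeffCode z g i))

/-- The relation `f * g = k` on lists of coefficient codes. The list `s` consists of the partial
sums of the convolution that defines the `i`-th coefficient. -/
def PolyMulRel (r : RingIndex) (z : ℕ) (f g k : List ℕ) : Prop :=
  ∀ i < f.length + g.length + k.length, ∃ s : List ℕ, s.getD 0 z = z ∧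
    (∀ j < i + 1, ∃ m, m ∈ r.2.2.eval (Nat.pair (coeffCode z f j) (coeffCode z g (i - j))) ∧
      s.getD (j + 1) z ∈ r.2.1.eval (Nat.pair (s.getD j z) m)) ∧
    s.getD (i + 1) z = coeffCode z k i

/-- The relation `k = c + (X - a) * q`, written `k + a * q = X * q + c` to avoid subtraction, on
codes of elements and lists of coefficient codes; `q ++ [c]` lists the coefficients of `X * q + c`,
one more than those of `q`, which accounts for the range of `i`. The relation is used both to build up polynomials in
Newton form and, read as a division with remainder, to evaluate `k` at `a`. -/
def HornerRel (r : RingIndex) (z a : ℕ) (q : List ℕ) (c : ℕ) (k : List ℕ) : Prop :=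
  ∀ i < q.length + k.length + 1, ∃ m, m ∈ r.2.2.eval (Nat.pair a (coeffCode z q i)) ∧
    coeffCode z (q ++ [c]) i ∈ r.2.1.eval (Nat.pair (coeffCode z k i) m)

section

variable {α : Type*} [Primcodable α] {r : α → RingIndex} {z a c : α → ℕ} {f g k : α → List ℕ}

@[fun_prop]
theorem Primrec.coeffCode_comp (hz : Primrec z) (hf : Primrec f) {i : α → ℕ} (hi : Primrec i) :
    Primrec fun a => coeffCode (z a) (f a) (i a) := by
  unfold coeffCode
  fun_prop

namespace REPred

theorem isZeroCode (hr : Primrec r) (hz : Primrec z) :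
    REPred fun x => IsZeroCode (r x) (z x) := by
  unfold IsZeroCode
  refine .and (.mem_eval ?_ ?_ ?_) (.mem_eval ?_ ?_ ?_) <;> fun_prop

theorem isPolyList (hr : Primrec r) (hz : Primrec z) (hf : Primrec f) :
    REPred fun x => IsPolyList (r x) (z x) (f x) := by
  unfold IsPolyList
  refine .and (.ne ?_ ?_) (.forall_mem (.mem_eval ?_ ?_ ?_) ?_) <;> fun_prop

theorem polyAddRel (hr : Primrec r) (hz : Primrec z) (hf : Primrec f) (hg : Primrec g)
    (hk : Primrec k) : REPred fun x => PolyAddRel (r x) (z x) (f x) (g x) (k x) := by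
  unfold PolyAddRel
  refine .forall_lt (.mem_eval ?_ ?_ ?_) ?_ <;> fun_prop

theorem polyMulRel (hr : Primrec r) (hz : Primrec z) (hf : Primrec f) (hg : Primrec g)
    (hk : Primrec k) : REPred fun x => PolyMulRel (r x) (z x) (f x) (g x) (k x) := by
  unfold PolyMulRel
  refine .forall_lt (.proj (.and (.eq ?_ ?_) (.and (.forall_lt (.proj
    (.and (.mem_eval ?_ ?_ ?_) (.mem_eval ?_ ?_ ?_))) ?_) (.eq ?_ ?_)))) ?_ <;> fun_prop

theorem hornerRel (hr : Primrec r) (hz : Primrec z) (ha : Primrec a) (hf : Primrec f)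
    (hc : Primrec c) (hk : Primrec k) :
    REPred fun x => HornerRel (r x) (z x) (a x) (f x) (c x) (k x) := by
  unfold HornerRel
  refine .forall_lt (.proj (.and (.mem_eval ?_ ?_ ?_) (.mem_eval ?_ ?_ ?_))) ?_ <;> fun_prop

end REPred

end

section

variable {A : Type*} [CommRing A] {ν : A → ℕ}

theorem length_polyList_of_ne_zero {f : A[X]} (hf : f ≠ 0) :
    (polyList ν f).length = f.natDegree + 1 := by
  classical
  simp [polyList, length_coeffList_eq_ite, hf]

theorem coeff_eq_zero_of_length_polyList_le {f : A[X]} {i : ℕ} (h : (polyList ν f).length ≤ i) :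
    f.coeff i = 0 := by
  by_cases hf : f = 0
  · simp [hf]
  · rw [length_polyList_of_ne_zero hf] at h
    exact coeff_eq_zero_of_natDegree_lt h

theorem coeffCode_map (l : List A) (i : ℕ) :
    coeffCode (ν 0) (l.map ν) i = ν (l.reverse.getD i 0) := by
  rw [coeffCode, ← List.map_reverse, List.getD_map]

theorem coeffCode_polyList (f : A[X]) (i : ℕ) :
    coeffCode (ν 0) (polyList ν f) i = ν (f.coeff i) := by
  rw [polyList, coeffCode_map]
  congr 1
  rw [coeffList, ← List.map_reverse, List.reverse_reverse]
  by_cases hi : i < f.degree.succ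
  · simp [List.getD_eq_getElem?_getD, hi]
  · have : f.coeff i = 0 := by
      refine coeff_eq_zero_of_length_polyList_le (ν := fun _ => 0) ?_
      simpa [polyList, length_coeffList_eq_withBotSucc_degree] using hi
    simp [List.getD_eq_getElem?_getD, hi, this]

theorem coeffCode_polyList_append (f : A[X]) (c : A) (i : ℕ) :
    coeffCode (ν 0) (polyList ν f ++ [ν c]) i = ν ((X * f + C c).coeff i) := by
  cases i with
  | zero => simp [coeffCode]
  | succ i =>
    rw [coeff_add, coeff_X_mul, coeff_C_succ, add_zero, ← coeffCode_polyList (ν := ν)]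
    simp [coeffCode]

theorem length_le_of_coeffCode_eq {z : ℕ} {l l' : List ℕ} (hl : l.head? ≠ some z)
    (h : ∀ i, coeffCode z l i = coeffCode z l' i) : l.length ≤ l'.length := by
  cases l with
  | nil => simp
  | cons x t =>
    by_contra! hlt
    have h1 := h t.length
    have h2 : l'.reverse.getD t.length z = z :=
      List.getD_eq_default _ _ (by simpa [Nat.lt_succ_iff] using hlt)
    rw [coeffCode, coeffCode, h2] at h1
    simp [List.getD_eq_getElem?_getD] at h1
    simp [h1] at hl

theorem eq_of_coeffCode_eq {z : ℕ} {l l' : List ℕ} (hl : l.head? ≠ some z)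
    (hl' : l'.head? ≠ some z) (h : ∀ i, coeffCode z l i = coeffCode z l' i) : l = l' := by
  have hlen := le_antisymm (length_le_of_coeffCode_eq hl h)
    (length_le_of_coeffCode_eq hl' fun i => (h i).symm)
  refine List.reverse_injective (List.ext_getElem (by simpa using hlen) fun i hi hi' => ?_)
  have := h i
  rwa [coeffCode, coeffCode, List.getD_eq_getElem _ _ hi, List.getD_eq_getElem _ _ hi'] at this

theorem head?_polyList_ne (hν : Function.Injective ν) (f : A[X]) :
    (polyList ν f).head? ≠ some (ν 0) := by
  by_cases hf : f = 0
  · simp [hf, polyList]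
  · rw [polyList, List.head?_map, head?_coeffList hf]
    simpa [hν.eq_iff] using hf

theorem exists_polyList_eq (hν : Function.Injective ν) {l : List ℕ} (hl : l.head? ≠ some (ν 0))
    (hmem : ∀ x ∈ l, x ∈ Set.range ν) : ∃ f : A[X], polyList ν f = l := by
  have : ∃ t : List A, t.map ν = l := by
    have : l ∈ Set.range (List.map ν) := by
      rw [Set.range_list_map]
      exact hmem
    exact this
  obtain ⟨t, rfl⟩ := this
  refine ⟨∑ i ∈ Finset.range t.length, monomial i (t.reverse.getD i 0),
    eq_of_coeffCode_eq (head?_polyList_ne hν _) hl fun i => ?_⟩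
  rw [coeffCode_polyList, coeffCode_map]
  simp only [finsetSum_coeff, coeff_monomial, Finset.sum_ite_eq', Finset.mem_range]
  split_ifs with h
  · rfl
  · rw [List.getD_eq_default]
    simpa using h

theorem polyList_injective (hν : Function.Injective ν) :
    Function.Injective (polyList ν : A[X] → List ℕ) := fun f g h => by
  ext i
  exact hν (by rw [← coeffCode_polyList (ν := ν), h, coeffCode_polyList])

theorem polyCode_eq_encode (f : A[X]) : polyCode ν f = encode (polyList ν f) := rfl

theorem polyCode_injective (hν : Function.Injective ν) :
    Function.Injective (polyCode ν : A[X] → ℕ) := fun _ _ h =>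
  polyList_injective hν (encode_injective h)

theorem polyList_eq_nil {f : A[X]} : polyList ν f = [] ↔ f = 0 := by
  simp [polyList]

theorem polyList_C {a : A} (ha : a ≠ 0) : polyList ν (C a) = [ν a] := by
  simp [polyList, coeffList_C ha]

variable {r : RingIndex}

namespace IsRingIndex

theorem one_mem_eval_iff (h : IsRingIndex ν r) {n : ℕ} : 1 ∈ r.1.eval n ↔ ∃ a, ν a = n := by
  refine ⟨fun h1 => ?_, fun hn => h.mem n hn⟩
  by_contra hn
  exact absurd (Part.mem_unique h1 (h.not_mem n hn)) one_ne_zero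

theorem zero_mem_eval_iff (h : IsRingIndex ν r) {n : ℕ} : 0 ∈ r.1.eval n ↔ n ∉ Set.range ν := by
  refine ⟨fun h0 hn => ?_, fun hn => h.not_mem n hn⟩
  exact absurd (Part.mem_unique (h.mem n hn) h0) one_ne_zero

theorem mem_add_iff (h : IsRingIndex ν r) {a b : A} {n : ℕ} :
    n ∈ r.2.1.eval (Nat.pair (ν a) (ν b)) ↔ n = ν (a + b) :=
  ⟨fun hn => Part.mem_unique hn (h.add a b), fun hn => hn ▸ h.add a b⟩

theorem mem_mul_iff (h : IsRingIndex ν r) {a b : A} {n : ℕ} :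
    n ∈ r.2.2.eval (Nat.pair (ν a) (ν b)) ↔ n = ν (a * b) :=
  ⟨fun hn => Part.mem_unique hn (h.mul a b), fun hn => hn ▸ h.mul a b⟩

theorem isZeroCode_iff (h : IsRingIndex ν r) {z : ℕ} : IsZeroCode r z ↔ z = ν 0 := by
  constructor
  · rintro ⟨h1, h2⟩
    obtain ⟨a, rfl⟩ := h.one_mem_eval_iff.1 h1
    have := h.injective (h.mem_add_iff.1 h2)
    rw [left_eq_add.1 this]
  · rintro rfl
    exact ⟨h.one_mem_eval_iff.2 ⟨0, rfl⟩, h.mem_add_iff.2 (by rw [add_zero])⟩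

theorem isPolyList_iff (h : IsRingIndex ν r) {l : List ℕ} :
    IsPolyList r (ν 0) l ↔ ∃ f : A[X], polyList ν f = l := by
  constructor
  · exact fun hl => exists_polyList_eq h.injective hl.1 fun x hx => h.one_mem_eval_iff.1 (hl.2 x hx)
  · rintro ⟨f, rfl⟩
    refine ⟨head?_polyList_ne h.injective f, fun x hx => h.one_mem_eval_iff.2 ?_⟩
    obtain ⟨a, -, ha⟩ := List.mem_map.1 hx
    exact ⟨a, ha⟩

theorem polyAddRel_iff (h : IsRingIndex ν r) {f g k : A[X]} :
    PolyAddRel r (ν 0) (polyList ν f) (polyList ν g) (polyList ν k) ↔ f + g = k := by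
  simp only [PolyAddRel, coeffCode_polyList, h.mem_add_iff, h.injective.eq_iff]
  refine ⟨fun H => Polynomial.ext fun i => ?_, fun H i _ => by rw [← H, coeff_add]⟩
  by_cases hi : i < (polyList ν f).length + (polyList ν g).length + (polyList ν k).length
  · rw [H i hi, coeff_add]
  · rw [coeff_add, coeff_eq_zero_of_length_polyList_le (ν := ν) (f := f) (by omega),
      coeff_eq_zero_of_length_polyList_le (ν := ν) (f := g) (by omega),
      coeff_eq_zero_of_length_polyList_le (ν := ν) (f := k) (by omega), add_zero]

theorem hornerRel_iff (h : IsRingIndex ν r) {a c : A} {q k : A[X]} :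
    HornerRel r (ν 0) (ν a) (polyList ν q) (ν c) (polyList ν k) ↔ k = C c + (X - C a) * q := by
  have : k = C c + (X - C a) * q ↔ k + C a * q = X * q + C c := by
    rw [← sub_eq_zero, ← sub_eq_zero (a := k + _)]
    ring_nf
  simp only [HornerRel, coeffCode_polyList, coeffCode_polyList_append, h.mem_mul_iff,
    exists_eq_left, h.mem_add_iff, h.injective.eq_iff, this]
  refine ⟨fun H => Polynomial.ext fun i => ?_, fun H i _ => by
    rw [← H, coeff_add, coeff_C_mul]⟩
  by_cases hi : i < (polyList ν q).length + (polyList ν k).length + 1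
  · rw [H i hi, coeff_add, coeff_C_mul]
  · obtain ⟨i, rfl⟩ : ∃ j, i = j + 1 := ⟨i - 1, by omega⟩
    rw [coeff_add, coeff_add, coeff_C_mul, coeff_X_mul, coeff_C_succ,
      coeff_eq_zero_of_length_polyList_le (ν := ν) (f := q) (i := i) (by omega),
      coeff_eq_zero_of_length_polyList_le (ν := ν) (f := q) (i := i + 1) (by omega),
      coeff_eq_zero_of_length_polyList_le (ν := ν) (f := k) (by omega), mul_zero]

theorem polyMulRel_iff (h : IsRingIndex ν r) {f g k : A[X]} :
    PolyMulRel r (ν 0) (polyList ν f) (polyList ν g) (polyList ν k) ↔ f * g = k := by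
  have hc : ∀ i, (f * g).coeff i = ∑ j ∈ Finset.range (i + 1), f.coeff j * g.coeff (i - j) :=
    fun i => by rw [coeff_mul, Finset.Nat.sum_antidiagonal_eq_sum_range_succ_mk]
  simp only [PolyMulRel, coeffCode_polyList, h.mem_mul_iff, exists_eq_left]
  constructor
  · intro H
    refine Polynomial.ext fun i => ?_
    by_cases hi : i < (polyList ν f).length + (polyList ν g).length + (polyList ν k).length
    · obtain ⟨s, hs0, hs, hsk⟩ := H i hi
      have : ∀ n ≤ i + 1,
          s.getD n (ν 0) = ν (∑ j ∈ Finset.range n, f.coeff j * g.coeff (i - j)) := by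
        intro n
        induction n with
        | zero => simpa using hs0
        | succ n ih =>
          intro hn
          have h1 := hs n (by omega)
          rw [ih (by omega), h.mem_add_iff] at h1
          rw [h1, Finset.sum_range_succ]
      rw [hc]
      exact h.injective (by rw [← this _ le_rfl, hsk])
    · rw [coeff_eq_zero_of_length_polyList_le (ν := ν) (f := k) (by omega), hc]
      refine Finset.sum_eq_zero fun j hj => ?_
      by_cases hjf : (polyList ν f).length ≤ j
      · rw [coeff_eq_zero_of_length_polyList_le hjf, zero_mul]
      · rw [coeff_eq_zero_of_length_polyList_le (ν := ν) (f := g) (by omega), mul_zero]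
  · rintro rfl i -
    refine ⟨(List.range (i + 2)).map fun n =>
      ν (∑ j ∈ Finset.range n, f.coeff j * g.coeff (i - j)), ?_, fun j hj => ?_, ?_⟩
    · simp [List.getD_eq_getElem?_getD]
    · have h1 : j < i + 2 := by omega
      have h2 : j + 1 < i + 2 := by omega
      simp [List.getD_eq_getElem?_getD, h1, h2, h.mem_add_iff, Finset.sum_range_succ]
    · simp [List.getD_eq_getElem?_getD, hc]

end IsRingIndex

end

/-! ### The divisor relation -/

/-- The list `B` contains the code of every divisor of the nonzero polynomial coded by `f`. This is
witnessed by points `a i`, lists `S i` of codes of elements and lists `L i` of codes of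
polynomials that have the closure properties required in `mem_of_dvd`. In the second clause, `v` is
the value of the polynomial at `a i`. -/
def DivisorBound (r : RingIndex) (d : Index) (z : ℕ) (f : List ℕ) (B : List (List ℕ)) : Prop :=
  ∃ a : List ℕ, ∃ S : List (List ℕ), ∃ L : List (List (List ℕ)),
    (∀ i < f.length, 1 ∈ r.1.eval (a.getD i 0) ∧ ∀ j < i, a.getD i 0 ≠ a.getD j 0) ∧
    (∀ i < f.length, ∃ q, IsPolyList r z q ∧ ∃ v, 1 ∈ r.1.eval v ∧ v ≠ z ∧
      HornerRel r z (a.getD i 0) q v f ∧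
      ∃ k, k ∈ d.eval v ∧ ∀ x ∈ canonicalFinset k, x ∈ S.getD 0 []) ∧
    (∀ i < f.length, z ∈ S.getD (i + 1) [] ∧ ∀ u ∈ S.getD i [], ∀ v ∈ S.getD i [], u = v ∨
      ∃ w, 1 ∈ r.1.eval w ∧ u ∈ r.2.1.eval (Nat.pair w v) ∧
        ∃ k, k ∈ d.eval w ∧ ∀ x ∈ canonicalFinset k, x ∈ S.getD (i + 1) []) ∧
    [] ∈ L.getD 0 [] ∧
    (∀ i < f.length, ∀ c ∈ S.getD (f.length - (i + 1)) [], ∀ g ∈ L.getD i [],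
      ∃ k, k ∈ L.getD (i + 1) [] ∧ IsPolyList r z k ∧ HornerRel r z (a.getD i 0) g c k) ∧
    B = L.getD f.length []

/-- `n` is the canonical index of the set of the divisors of the nonzero polynomial coded by `f`:
of the polynomials in a list that contains all the divisors, those whose product with some other
one is `f`. -/
def DivisorRel (r : RingIndex) (d : Index) (z : ℕ) (f : List ℕ) (n : ℕ) : Prop :=
  ∃ B, DivisorBound r d z f B ∧
    (∀ x ∈ canonicalFinset n, ∃ g : List ℕ, encode g = x ∧ IsPolyList r z g ∧
      ∃ k, IsPolyList r z k ∧ PolyMulRel r z g k f) ∧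
    ∀ g ∈ B, encode g ∈ canonicalFinset n ∨
      ∀ k ∈ B, ∃ p, IsPolyList r z p ∧ p ≠ f ∧ PolyMulRel r z g k p

/-- The list of coefficient codes of the constant polynomial with the value coded by `x`. -/
def constList (z x : ℕ) : List ℕ := if x = z then [] else [x]

/-- `n` is the canonical index of the set of constant polynomials that corresponds to the value
of the function with index `d` at zero. -/
def ZeroDivisorRel (d : Index) (z n : ℕ) : Prop :=
  ∃ k, k ∈ d.eval z ∧ (∀ x ∈ canonicalFinset k, encode (constList z x) ∈ canonicalFinset n) ∧
    ∀ y ∈ canonicalFinset n, ∃ x, x ∈ canonicalFinset k ∧ y = encode (constList z x)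

/-- The graph of the divisor function on the polynomial ring: `n` is its value at the polynomial
with code `x`. -/
def PolyDivisorGraph (r : RingIndex) (d : Index) (x n : ℕ) : Prop :=
  ∃ z, IsZeroCode r z ∧ ∃ f : List ℕ, encode f = x ∧
    ((f = [] ∧ ZeroDivisorRel d z n) ∨ (f ≠ [] ∧ DivisorRel r d z f n))

/-- The graph of the decision procedure for the set of codes of polynomials. -/
def PolyMemGraph (r : RingIndex) (x b : ℕ) : Prop :=
  ∃ z, IsZeroCode r z ∧ ∃ l : List ℕ, encode l = x ∧
    ((b = 1 ∧ IsPolyList r z l) ∨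
      (b = 0 ∧ (l.head? = some z ∨ ∃ y, y ∈ l ∧ 0 ∈ r.1.eval y)))

/-- The graph of the addition of polynomials. -/
def PolyAddGraph (r : RingIndex) (x y : ℕ) : Prop :=
  ∃ z, IsZeroCode r z ∧ ∃ f g k : List ℕ, x = Nat.pair (encode f) (encode g) ∧
    y = encode k ∧ IsPolyList r z k ∧ PolyAddRel r z f g k

/-- The graph of the multiplication of polynomials. -/
def PolyMulGraph (r : RingIndex) (x y : ℕ) : Prop :=
  ∃ z, IsZeroCode r z ∧ ∃ f g k : List ℕ, x = Nat.pair (encode f) (encode g) ∧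
    y = encode k ∧ IsPolyList r z k ∧ PolyMulRel r z f g k

section

variable {α : Type*} [Primcodable α] {r : α → RingIndex} {d : α → Index} {z x n : α → ℕ}
  {f : α → List ℕ}

@[fun_prop]
theorem Primrec.constList_comp (hz : Primrec z) (hx : Primrec x) :
    Primrec fun a => constList (z a) (x a) := by
  unfold constList
  exact Primrec.ite (Primrec.eq.comp hx hz) (by fun_prop) (by fun_prop)

namespace REPred

theorem divisorBound {B : α → List (List ℕ)} (hr : Primrec r) (hd : Primrec d) (hz : Primrec z)
    (hf : Primrec f) (hB : Primrec B) :
    REPred fun x => DivisorBound (r x) (d x) (z x) (f x) (B x) := by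
  unfold DivisorBound
  refine .proj (.proj (.proj (.and ?_ (.and ?_ (.and ?_ (.and ?_ (.and ?_ ?_)))))))
  · refine .forall_lt (.and (.mem_eval ?_ ?_ ?_) (.forall_lt (.ne ?_ ?_) ?_)) ?_ <;> fun_prop
  · refine .forall_lt (.proj (.and (.isPolyList ?_ ?_ ?_) (.proj (.and (.mem_eval ?_ ?_ ?_)
      (.and (.ne ?_ ?_) (.and (.hornerRel ?_ ?_ ?_ ?_ ?_ ?_) (.proj (.and (.mem_eval ?_ ?_ ?_)
      (.forall_mem_canonicalFinset (.mem ?_ ?_) ?_))))))))) ?_ <;> fun_prop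
  · refine .forall_lt (.and (.mem ?_ ?_) (.forall_mem (.forall_mem (.or (.eq ?_ ?_)
      (.proj (.and (.mem_eval ?_ ?_ ?_) (.and (.mem_eval ?_ ?_ ?_) (.proj (.and (.mem_eval ?_ ?_ ?_)
      (.forall_mem_canonicalFinset (.mem ?_ ?_) ?_))))))) ?_) ?_)) ?_ <;> fun_prop
  · refine .mem ?_ ?_ <;> fun_prop
  · refine .forall_lt (.forall_mem (.forall_mem (.proj (.and (.mem ?_ ?_)
      (.and (.isPolyList ?_ ?_ ?_) (.hornerRel ?_ ?_ ?_ ?_ ?_ ?_)))) ?_) ?_) ?_ <;> fun_prop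
  · refine .eq ?_ ?_ <;> fun_prop

theorem divisorRel (hr : Primrec r) (hd : Primrec d) (hz : Primrec z) (hf : Primrec f)
    (hn : Primrec n) : REPred fun x => DivisorRel (r x) (d x) (z x) (f x) (n x) := by
  unfold DivisorRel
  refine .proj (.and (.divisorBound ?_ ?_ ?_ ?_ ?_) (.and
    (.forall_mem_canonicalFinset (.proj (.and (.eq ?_ ?_) (.and (.isPolyList ?_ ?_ ?_) (.proj
      (.and (.isPolyList ?_ ?_ ?_) (.polyMulRel ?_ ?_ ?_ ?_ ?_)))))) ?_)
    (.forall_mem (.or (.mem_canonicalFinset ?_ ?_) (.forall_mem (.proj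
      (.and (.isPolyList ?_ ?_ ?_) (.and (.ne ?_ ?_) (.polyMulRel ?_ ?_ ?_ ?_ ?_)))) ?_)) ?_)))
    <;> fun_prop

theorem zeroDivisorRel (hd : Primrec d) (hz : Primrec z) (hn : Primrec n) :
    REPred fun x => ZeroDivisorRel (d x) (z x) (n x) := by
  unfold ZeroDivisorRel
  refine .proj (.and (.mem_eval ?_ ?_ ?_) (.and
    (.forall_mem_canonicalFinset (.mem_canonicalFinset ?_ ?_) ?_)
    (.forall_mem_canonicalFinset (.proj (.and (.mem_canonicalFinset ?_ ?_) (.eq ?_ ?_))) ?_)))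
    <;> fun_prop

theorem polyDivisorGraph (hr : Primrec r) (hd : Primrec d) (hx : Primrec x) (hn : Primrec n) :
    REPred fun a => PolyDivisorGraph (r a) (d a) (x a) (n a) := by
  unfold PolyDivisorGraph
  refine .proj (.and (.isZeroCode ?_ ?_) (.proj (.and (.eq ?_ ?_) (.or
    (.and (.eq ?_ ?_) (.zeroDivisorRel ?_ ?_ ?_))
    (.and (.ne ?_ ?_) (.divisorRel ?_ ?_ ?_ ?_ ?_)))))) <;> fun_prop

theorem polyMemGraph (hr : Primrec r) (hx : Primrec x) (hn : Primrec n) :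
    REPred fun a => PolyMemGraph (r a) (x a) (n a) := by
  unfold PolyMemGraph
  refine .proj (.and (.isZeroCode ?_ ?_) (.proj (.and (.eq ?_ ?_) (.or
    (.and (.eq ?_ ?_) (.isPolyList ?_ ?_ ?_))
    (.and (.eq ?_ ?_) (.or (.eq ?_ ?_) (.proj (.and (.mem ?_ ?_) (.mem_eval ?_ ?_ ?_))))))))) <;>
  fun_prop

theorem polyAddGraph (hr : Primrec r) (hx : Primrec x) (hn : Primrec n) :
    REPred fun a => PolyAddGraph (r a) (x a) (n a) := by
  unfold PolyAddGraph
  refine .proj (.and (.isZeroCode ?_ ?_) (.proj (.proj (.proj (.and (.eq ?_ ?_)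
    (.and (.eq ?_ ?_) (.and (.isPolyList ?_ ?_ ?_) (.polyAddRel ?_ ?_ ?_ ?_ ?_)))))))) <;> fun_prop

theorem polyMulGraph (hr : Primrec r) (hx : Primrec x) (hn : Primrec n) :
    REPred fun a => PolyMulGraph (r a) (x a) (n a) := by
  unfold PolyMulGraph
  refine .proj (.and (.isZeroCode ?_ ?_) (.proj (.proj (.proj (.and (.eq ?_ ?_)
    (.and (.eq ?_ ?_) (.and (.isPolyList ?_ ?_ ?_) (.polyMulRel ?_ ?_ ?_ ?_ ?_)))))))) <;> fun_prop

end REPred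

end

section

theorem getD_map_range {β : Type*} (g : ℕ → β) {n i : ℕ} (hi : i < n) (b : β) :
    ((List.range n).map g).getD i b = g i := by
  simp [List.getD_eq_getElem?_getD, hi]

variable {A : Type*} [CommRing A] {ν : A → ℕ} {r : RingIndex} {d : Index}

theorem IsDivisorIndex.mem_canonicalFinset_iff (hd : IsDivisorIndex ν d) {a : A} (ha : a ≠ 0)
    {k : ℕ} (hk : k ∈ d.eval (ν a)) {x : ℕ} : x ∈ canonicalFinset k ↔ ∃ b, b ∣ a ∧ ν b = x := by
  obtain ⟨n, hn, hc⟩ := hd a ha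
  rw [Part.mem_unique hk hn, ← Finset.mem_coe, show _ = _ from hc]
  rfl

theorem IsDivisorIndex.finite_dvd (hν : Function.Injective ν) (hd : IsDivisorIndex ν d) {a : A}
    (ha : a ≠ 0) : {b | b ∣ a}.Finite := by
  obtain ⟨n, -, hc⟩ := hd a ha
  refine Set.Finite.of_finite_image ?_ hν.injOn
  rw [← show _ = _ from hc]
  exact Finset.finite_toSet _

namespace IsRingIndex

theorem mem_of_divisorBound [IsDomain A] (h : IsRingIndex ν r) (hd : IsDivisorIndex ν d)
    {f : A[X]} (hf : f ≠ 0) {B : List (List ℕ)} (hB : DivisorBound r d (ν 0) (polyList ν f) B)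
    {g : A[X]} (hg : g ∣ f) : polyList ν g ∈ B := by
  obtain ⟨a, S, L, ha, hv, hS, hL0, hL, rfl⟩ := hB
  choose! b hb using fun i hi => h.one_mem_eval_iff.1 (ha i hi).1
  refine mem_of_dvd hf (N := (polyList ν f).length) (a := b)
    (S := fun i => {x | ν x ∈ S.getD i []}) (L := fun i => {g | polyList ν g ∈ L.getD i []})
    ?_ ?_ ?_ ?_ ?_ ?_ ?_ hg
  · simp [length_polyList_of_ne_zero hf]
  · intro i hi j hj hij
    exact (ha i hi).2 j hj (by rw [← hb i hi, ← hb j (hj.trans hi), hij])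
  · intro i hi w hw
    obtain ⟨q, hq, v, hv1, hv0, hh, k, hk, hkS⟩ := hv i hi
    obtain ⟨q, rfl⟩ := h.isPolyList_iff.1 hq
    obtain ⟨v, rfl⟩ := h.one_mem_eval_iff.1 hv1
    rw [← hb i hi, h.hornerRel_iff] at hh
    have : f.eval (b i) = v := by simp [hh]
    rw [this] at hw
    exact hkS _ ((hd.mem_canonicalFinset_iff (fun h0 => hv0 (by rw [h0])) hk).2 ⟨w, hw, rfl⟩)
  · exact fun i hi => (hS i hi).1
  · intro i hi u hu v hv huv w hw
    obtain h1 | ⟨y, hy, hyu, k, hk, hkS⟩ := (hS i hi).2 _ hu _ hv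
    · exact absurd (h.injective h1) huv
    · obtain ⟨y, rfl⟩ := h.one_mem_eval_iff.1 hy
      have hy : u - v = y := by rw [h.injective (h.mem_add_iff.1 hyu), add_sub_cancel_right]
      rw [hy] at hw
      exact hkS _ ((hd.mem_canonicalFinset_iff (hy ▸ sub_ne_zero.2 huv) hk).2 ⟨w, hw, rfl⟩)
  · simpa [polyList] using hL0
  · intro i hi c hc g hg
    obtain ⟨k, hk, hkp, hh⟩ := hL i hi _ hc _ hg
    obtain ⟨k, rfl⟩ := h.isPolyList_iff.1 hkp
    rw [← hb i hi, h.hornerRel_iff] at hh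
    exact hh ▸ hk

theorem exists_divisorBound [IsDomain A] [Infinite A] (h : IsRingIndex ν r)
    (hd : IsDivisorIndex ν d) {f : A[X]} (hf : f ≠ 0) :
    ∃ B, DivisorBound r d (ν 0) (polyList ν f) B ∧ ∀ l ∈ B, ∃ g : A[X], polyList ν g = l := by
  classical
  obtain ⟨a, ha, hfa⟩ := exists_injective_eval_ne_zero hf
  have hfin : ∀ b : A, b ≠ 0 → {w | w ∣ b}.Finite := fun b hb => hd.finite_dvd h.injective hb
  choose! D hD using fun b hb => (hfin b hb).exists_finset
  set N := (polyList ν f).length with hN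
  obtain ⟨S, hS0, hS⟩ := exists_finset_mem_of_dvd_sub hfin
    ((Finset.range N).biUnion fun i => D (f.eval (a i)))
  obtain ⟨L, hL0, hL⟩ := exists_finset_newton_mem a fun i => S (N - (i + 1))
  have hSget : ∀ i ≤ N, ((List.range (N + 1)).map fun i => (S i).toList.map ν).getD i [] =
    (S i).toList.map ν := fun i hi => getD_map_range _ (by omega) _
  have hLget : ∀ i ≤ N,
    ((List.range (N + 1)).map fun i => (L i).toList.map (polyList ν)).getD i [] =
      (L i).toList.map (polyList ν) := fun i hi => getD_map_range _ (by omega) _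
  have haget : ∀ i < N, ((List.range N).map fun i => ν (a i)).getD i 0 = ν (a i) :=
    fun i hi => getD_map_range _ hi _
  refine ⟨(L N).toList.map (polyList ν), ⟨(List.range N).map fun i => ν (a i),
    (List.range (N + 1)).map fun i => (S i).toList.map ν,
    (List.range (N + 1)).map fun i => (L i).toList.map (polyList ν),
    fun i hi => ?_, fun i hi => ?_, fun i hi => ?_, ?_, fun i hi => ?_, ?_⟩, ?_⟩
  · rw [haget i hi]
    refine ⟨h.one_mem_eval_iff.2 ⟨_, rfl⟩, fun j hj => ?_⟩
    rw [haget j (hj.trans hi)]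
    exact fun hij => hj.ne' (ha (h.injective hij))
  · rw [haget i hi, hSget 0 (Nat.zero_le _)]
    obtain ⟨k, hk, -⟩ := hd _ (hfa i)
    refine ⟨_, h.isPolyList_iff.2 ⟨f /ₘ (X - C (a i)), rfl⟩, ν (f.eval (a i)),
      h.one_mem_eval_iff.2 ⟨_, rfl⟩, h.injective.ne (hfa i), h.hornerRel_iff.2 ?_, k, hk,
      fun x hx => ?_⟩
    · rw [← modByMonic_X_sub_C_eq_C_eval]
      exact (modByMonic_add_div f (X - C (a i))).symm
    · obtain ⟨w, hw, rfl⟩ := (hd.mem_canonicalFinset_iff (hfa i) hk).1 hx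
      refine List.mem_map_of_mem (Finset.mem_toList.2 ?_)
      rw [hS0]
      exact Finset.mem_biUnion.2 ⟨i, Finset.mem_range.2 hi, (hD _ (hfa i) w).2 hw⟩
  · rw [hSget i (by omega), hSget (i + 1) (by omega)]
    refine ⟨List.mem_map_of_mem (Finset.mem_toList.2 (hS i).1), fun u hu v hv => ?_⟩
    obtain ⟨u, hu', rfl⟩ := List.mem_map.1 hu
    obtain ⟨v, hv', rfl⟩ := List.mem_map.1 hv
    rw [Finset.mem_toList] at hu' hv'
    by_cases huv : u = v
    · exact .inl (by rw [huv])
    · obtain ⟨k, hk, -⟩ := hd _ (sub_ne_zero.2 huv)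
      refine .inr ⟨ν (u - v), h.one_mem_eval_iff.2 ⟨_, rfl⟩,
        h.mem_add_iff.2 (by rw [sub_add_cancel]), k, hk, fun x hx => ?_⟩
      obtain ⟨w, hw, rfl⟩ := (hd.mem_canonicalFinset_iff (sub_ne_zero.2 huv) hk).1 hx
      exact List.mem_map_of_mem (Finset.mem_toList.2 ((hS i).2 u hu' v hv' huv w hw))
  · rw [hLget 0 (Nat.zero_le _)]
    exact List.mem_map.2 ⟨0, Finset.mem_toList.2 hL0, by simp [polyList]⟩
  · rw [← hN, hSget _ (by omega), hLget i (by omega), hLget (i + 1) (by omega), haget i hi]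
    intro c hc g hg
    obtain ⟨c, hc', rfl⟩ := List.mem_map.1 hc
    obtain ⟨g, hg', rfl⟩ := List.mem_map.1 hg
    rw [Finset.mem_toList] at hc' hg'
    exact ⟨_, List.mem_map_of_mem (Finset.mem_toList.2 (hL i c hc' g hg')),
      h.isPolyList_iff.2 ⟨_, rfl⟩, h.hornerRel_iff.2 rfl⟩
  · rw [← hN, hLget N le_rfl]
  · intro l hl
    obtain ⟨g, -, rfl⟩ := List.mem_map.1 hl
    exact ⟨g, rfl⟩

theorem isCanonicalIndex_of_divisorRel [IsDomain A] (h : IsRingIndex ν r)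
    (hd : IsDivisorIndex ν d) {f : A[X]} (hf : f ≠ 0) {n : ℕ}
    (hn : DivisorRel r d (ν 0) (polyList ν f) n) :
    IsCanonicalIndex (polyCode ν) n {g | g ∣ f} := by
  obtain ⟨B, hB, h1, h2⟩ := hn
  ext x
  rw [Finset.mem_coe]
  constructor
  · intro hx
    obtain ⟨g, rfl, hg, k, hk, hm⟩ := h1 x hx
    obtain ⟨g, rfl⟩ := h.isPolyList_iff.1 hg
    obtain ⟨k, rfl⟩ := h.isPolyList_iff.1 hk
    exact ⟨g, ⟨k, (h.polyMulRel_iff.1 hm).symm⟩, rfl⟩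
  · rintro ⟨g, ⟨k, hgk⟩, rfl⟩
    refine (h2 _ (h.mem_of_divisorBound hd hf hB ⟨k, hgk⟩)).resolve_right fun H => ?_
    obtain ⟨p, hp, hpf, hm⟩ := H _ (h.mem_of_divisorBound hd hf hB ⟨g, hgk.trans (mul_comm _ _)⟩)
    obtain ⟨p, rfl⟩ := h.isPolyList_iff.1 hp
    exact hpf (by rw [hgk, h.polyMulRel_iff.1 hm])

theorem exists_divisorRel [IsDomain A] [Infinite A] (h : IsRingIndex ν r)
    (hd : IsDivisorIndex ν d) {f : A[X]} (hf : f ≠ 0) :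
    ∃ n, DivisorRel r d (ν 0) (polyList ν f) n := by
  obtain ⟨B, hB, hBp⟩ := h.exists_divisorBound hd hf
  have hfin : (polyCode ν '' {g | g ∣ f}).Finite := by
    refine (B.map encode).finite_toSet.subset ?_
    rintro - ⟨g, hg, rfl⟩
    exact List.mem_map.2 ⟨_, h.mem_of_divisorBound hd hf hB hg, rfl⟩
  obtain ⟨n, hn⟩ := exists_canonicalFinset_eq hfin.toFinset
  refine ⟨n, B, hB, fun x hx => ?_, fun g hg => ?_⟩
  · rw [hn, Set.Finite.mem_toFinset] at hx
    obtain ⟨g, ⟨k, hk⟩, rfl⟩ := hx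
    exact ⟨_, rfl, h.isPolyList_iff.2 ⟨g, rfl⟩, _, h.isPolyList_iff.2 ⟨k, rfl⟩,
      h.polyMulRel_iff.2 hk.symm⟩
  · obtain ⟨g, rfl⟩ := hBp g hg
    by_cases hgf : g ∣ f
    · left
      rw [hn, Set.Finite.mem_toFinset]
      exact ⟨g, hgf, rfl⟩
    · refine .inr fun k hk => ?_
      obtain ⟨k, rfl⟩ := hBp k hk
      exact ⟨_, h.isPolyList_iff.2 ⟨g * k, rfl⟩,
        fun hp => hgf ⟨k, (polyList_injective h.injective hp).symm⟩, h.polyMulRel_iff.2 rfl⟩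

theorem polyList_C_eq (h : IsRingIndex ν r) (a : A) :
    polyList ν (C a) = constList (ν 0) (ν a) := by
  by_cases ha : a = 0
  · simp [ha, constList, polyList]
  · rw [polyList_C ha, constList, if_neg (h.injective.ne ha)]

theorem isCanonicalIndex_of_zeroDivisorRel (h : IsRingIndex ν r) {k n : ℕ}
    (hk : k ∈ d.eval (ν 0)) (hn : ZeroDivisorRel d (ν 0) n) {s : Set A}
    (hs : IsCanonicalIndex ν k s) : IsCanonicalIndex (polyCode ν) n (C '' s) := by
  obtain ⟨k', hk', h1, h2⟩ := hn
  obtain rfl := Part.mem_unique hk hk'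
  have hmem : ∀ x, x ∈ canonicalFinset k ↔ x ∈ ν '' s := fun x => by
    rw [← Finset.mem_coe, show _ = _ from hs]
  ext x
  rw [Finset.mem_coe]
  constructor
  · intro hx
    obtain ⟨y, hy, rfl⟩ := h2 x hx
    obtain ⟨a, ha, rfl⟩ := (hmem y).1 hy
    exact ⟨C a, ⟨a, ha, rfl⟩, by rw [polyCode_eq_encode, h.polyList_C_eq]⟩
  · rintro ⟨-, ⟨a, ha, rfl⟩, rfl⟩
    rw [polyCode_eq_encode, h.polyList_C_eq]
    exact h1 _ ((hmem _).2 ⟨a, ha, rfl⟩)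

theorem exists_zeroDivisorRel {z k : ℕ} (hk : k ∈ d.eval z) : ∃ n, ZeroDivisorRel d z n := by
  obtain ⟨n, hn⟩ := exists_canonicalFinset_eq
    ((canonicalFinset k).image fun x => encode (constList z x))
  refine ⟨n, k, hk, fun x hx => ?_, fun y hy => ?_⟩
  · rw [hn]
    exact Finset.mem_image_of_mem _ hx
  · rw [hn] at hy
    obtain ⟨x, hx, rfl⟩ := Finset.mem_image.1 hy
    exact ⟨x, hx, rfl⟩

theorem polyDivisorGraph_zero_iff (h : IsRingIndex ν r) {n : ℕ} :
    PolyDivisorGraph r d (polyCode ν (0 : A[X])) n ↔ ZeroDivisorRel d (ν 0) n := by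
  simp only [PolyDivisorGraph, h.isZeroCode_iff, exists_eq_left, polyCode_eq_encode,
    encode_inj, polyList_eq_nil, ne_eq, not_true_eq_false, true_and, false_and, or_false]

theorem polyDivisorGraph_iff (h : IsRingIndex ν r) {f : A[X]} (hf : f ≠ 0) {n : ℕ} :
    PolyDivisorGraph r d (polyCode ν f) n ↔ DivisorRel r d (ν 0) (polyList ν f) n := by
  simp only [PolyDivisorGraph, h.isZeroCode_iff, exists_eq_left, polyCode_eq_encode,
    encode_inj, polyList_eq_nil, hf, ne_eq, not_false_eq_true, true_and, false_and, false_or]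

theorem polyMemGraph_iff (h : IsRingIndex ν r) {x b : ℕ} :
    PolyMemGraph r x b ↔
      (b = 1 ∧ x ∈ Set.range (polyCode ν)) ∨ (b = 0 ∧ x ∉ Set.range (polyCode ν)) := by
  obtain ⟨l, rfl⟩ : ∃ l : List ℕ, encode l = x := ⟨Denumerable.ofNat _ x, Denumerable.encode_ofNat x⟩
  have h1 : encode l ∈ Set.range (polyCode ν) ↔ IsPolyList r (ν 0) l := by
    simp only [h.isPolyList_iff, Set.mem_range, polyCode_eq_encode, encode_inj]
  have h2 : (l.head? = some (ν 0) ∨ ∃ y, y ∈ l ∧ 0 ∈ r.1.eval y) ↔ ¬IsPolyList r (ν 0) l := by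
    simp only [IsPolyList, h.zero_mem_eval_iff, h.one_mem_eval_iff, not_and_or, not_not, not_forall,
      Set.mem_range, exists_prop]
  simp only [PolyMemGraph, h.isZeroCode_iff, exists_eq_left, encode_inj, h1, h2]

theorem polyAddGraph_iff (h : IsRingIndex ν r) {f g : A[X]} {y : ℕ} :
    PolyAddGraph r (Nat.pair (polyCode ν f) (polyCode ν g)) y ↔ y = polyCode ν (f + g) := by
  simp only [PolyAddGraph, h.isZeroCode_iff, exists_eq_left, Nat.pair_eq_pair, polyCode_eq_encode,
    encode_inj]
  constructor
  · rintro ⟨_, _, k, ⟨rfl, rfl⟩, rfl, hk, hadd⟩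
    obtain ⟨k, rfl⟩ := h.isPolyList_iff.1 hk
    rw [h.polyAddRel_iff.1 hadd]
  · rintro rfl
    exact ⟨_, _, _, ⟨rfl, rfl⟩, rfl, h.isPolyList_iff.2 ⟨_, rfl⟩, h.polyAddRel_iff.2 rfl⟩

theorem polyMulGraph_iff (h : IsRingIndex ν r) {f g : A[X]} {y : ℕ} :
    PolyMulGraph r (Nat.pair (polyCode ν f) (polyCode ν g)) y ↔ y = polyCode ν (f * g) := by
  simp only [PolyMulGraph, h.isZeroCode_iff, exists_eq_left, Nat.pair_eq_pair, polyCode_eq_encode,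
    encode_inj]
  constructor
  · rintro ⟨_, _, k, ⟨rfl, rfl⟩, rfl, hk, hmul⟩
    obtain ⟨k, rfl⟩ := h.isPolyList_iff.1 hk
    rw [h.polyMulRel_iff.1 hmul]
  · rintro rfl
    exact ⟨_, _, _, ⟨rfl, rfl⟩, rfl, h.isPolyList_iff.2 ⟨_, rfl⟩, h.polyMulRel_iff.2 rfl⟩

end IsRingIndex

end

/-! ### Computable index transformations -/

theorem exists_computable_polyRingIndex : ∃ R : RingIndex → RingIndex, Computable R ∧
    ∀ (A : Type u) [CommRing A] (ν : A → ℕ) (r : RingIndex), IsRingIndex ν r →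
      IsRingIndex (polyCode ν) (R r) := by
  obtain ⟨M, hM, hM'⟩ := REPred.exists_computable_index (P := PolyMemGraph)
    (.polyMemGraph (by fun_prop) (by fun_prop) (by fun_prop))
  obtain ⟨S, hS, hS'⟩ := REPred.exists_computable_index (P := PolyAddGraph)
    (.polyAddGraph (by fun_prop) (by fun_prop) (by fun_prop))
  obtain ⟨T, hT, hT'⟩ := REPred.exists_computable_index (P := PolyMulGraph)
    (.polyMulGraph (by fun_prop) (by fun_prop) (by fun_prop))
  refine ⟨fun r => (M r, S r, T r), hM.pair (hS.pair hT), fun A _ ν r h =>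
    ⟨polyCode_injective h.injective, fun x hx => ?_, fun x hx => ?_, fun f g => ?_, fun f g => ?_⟩⟩
  · obtain ⟨b, hb, hP⟩ := (hM' r x).2 ⟨1, h.polyMemGraph_iff.2 (.inl ⟨rfl, hx⟩)⟩
    obtain ⟨rfl, -⟩ | ⟨-, hx'⟩ := h.polyMemGraph_iff.1 hP
    exacts [hb, absurd hx hx']
  · obtain ⟨b, hb, hP⟩ := (hM' r x).2 ⟨0, h.polyMemGraph_iff.2 (.inr ⟨rfl, hx⟩)⟩
    obtain ⟨-, hx'⟩ | ⟨rfl, -⟩ := h.polyMemGraph_iff.1 hP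
    exacts [absurd hx' hx, hb]
  · obtain ⟨y, hy, hP⟩ := (hS' r _).2 ⟨_, h.polyAddGraph_iff.2 rfl⟩
    exact h.polyAddGraph_iff.1 hP ▸ hy
  · obtain ⟨y, hy, hP⟩ := (hT' r _).2 ⟨_, h.polyMulGraph_iff.2 rfl⟩
    exact h.polyMulGraph_iff.1 hP ▸ hy

theorem exists_computable_polyDivisorIndex : ∃ Δ : RingIndex × Index → Index, Computable Δ ∧
    ∀ (A : Type u) [CommRing A] [IsDomain A] [Infinite A] (ν : A → ℕ) (r : RingIndex) (d : Index),
      IsRingIndex ν r → IsDivisorIndex ν d →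
        IsDivisorIndex (polyCode ν) (Δ (r, d)) ∧ ExtendsToPoly ν d (Δ (r, d)) := by
  obtain ⟨Δ, hΔ, hΔ'⟩ := REPred.exists_computable_index
    (P := fun s : RingIndex × Index => PolyDivisorGraph s.1 s.2)
    (.polyDivisorGraph (by fun_prop) (by fun_prop) (by fun_prop) (by fun_prop))
  refine ⟨Δ, hΔ, fun A _ _ _ ν r d h hd => ?_⟩
  have hdiv : IsDivisorIndex (polyCode ν) (Δ (r, d)) := fun f hf => by
    obtain ⟨n, hn⟩ := h.exists_divisorRel hd hf
    obtain ⟨y, hy, hP⟩ := (hΔ' (r, d) _).2 ⟨n, (h.polyDivisorGraph_iff hf).2 hn⟩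
    exact ⟨y, hy, h.isCanonicalIndex_of_divisorRel hd hf ((h.polyDivisorGraph_iff hf).1 hP)⟩
  refine ⟨hdiv, fun a k hk => ?_⟩
  by_cases ha : a = 0
  · subst ha
    rw [C_0]
    obtain ⟨n, hn⟩ := IsRingIndex.exists_zeroDivisorRel hk
    obtain ⟨y, hy, hP⟩ := (hΔ' (r, d) _).2 ⟨n, h.polyDivisorGraph_zero_iff.2 hn⟩
    exact ⟨y, hy, fun s hs =>
      h.isCanonicalIndex_of_zeroDivisorRel hk (h.polyDivisorGraph_zero_iff.1 hP) hs⟩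
  · obtain ⟨n, hn, hc⟩ := hdiv (C a) (C_ne_zero.2 ha)
    refine ⟨n, hn, fun s hs => ?_⟩
    have hs' : s = {b | b ∣ a} := by
      ext b
      rw [← h.injective.mem_set_image, ← show _ = _ from hs, Finset.mem_coe,
        hd.mem_canonicalFinset_iff ha hk]
      simp [h.injective.eq_iff]
    have hC : (C '' s : Set A[X]) = {g | g ∣ C a} := by
      rw [hs']
      ext g
      constructor
      · rintro ⟨b, hb, rfl⟩
        exact (map_dvd C hb : _)
      · intro hg
        -- A divisor of a nonzero constant has degree zero, since `A` has no zero divisors.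
        have hdeg : g.natDegree = 0 := by
          have := natDegree_le_of_dvd hg (C_ne_zero.2 ha)
          rwa [natDegree_C, Nat.le_zero] at this
        obtain ⟨b, rfl⟩ := natDegree_eq_zero.1 hdeg
        exact ⟨b, by simpa using eval_dvd (x := 0) hg, rfl⟩
    rw [hC]
    exact hc

theorem theoremt :
    (∀ (A : Type u) [CommRing A] [Infinite A] (ν : A → ℕ),
      IsSCFFD A ν → Infinite A[X] ∧ IsSCFFD A[X] (polyCode ν)) ∧
    ∃ (R : RingIndex → RingIndex) (Δ : RingIndex × Index → Index),
      Computable R ∧ Computable Δ ∧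
        ∀ (A : Type u) [CommRing A] [IsDomain A] [Infinite A] (ν : A → ℕ)
          (r : RingIndex) (d : Index),
          IsRingIndex ν r → IsDivisorIndex ν d →
            IsRingIndex (polyCode ν) (R r) ∧
            IsDivisorIndex (polyCode ν) (Δ (r, d)) ∧
            ExtendsToPoly ν d (Δ (r, d)) := by
  obtain ⟨R, hR, hR'⟩ := exists_computable_polyRingIndex.{u}
  obtain ⟨Δ, hΔ, hΔ'⟩ := exists_computable_polyDivisorIndex.{u}
  refine ⟨fun A _ _ ν ⟨hA, ⟨r, hr⟩, d, hd⟩ => ?_, R, Δ, hR, hΔ, fun A _ _ _ ν r d hr hd =>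
    ⟨hR' A ν r hr, hΔ' A ν r d hr hd⟩⟩
  exact ⟨Infinite.of_injective C C_injective, inferInstance, ⟨R r, hR' A ν r hr⟩,
    Δ (r, d), (hΔ' A ν r d hr hd).1⟩
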